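/- For $n\ge 1$ let $Z_1,\dots,Z_n$ be independent Poisson random variables on a probability space $(\Omega,\mathcal F,P)$ with $\mathbb E Z_j=1/j$, and for $1\le r\le n$ put $\ell_r(\bar Z)=1Z_1+2Z_2+\cdots+rZ_r$. Let $\rho$ be the Dickman function, that is, the continuous function on $[0,\infty)$ with $\rho(u)=1$ for $0\le u\le 1$ and $u\rho'(u)+\rho(u-1)=0$ for $u>1$, and let $\gamma$ be the Euler--Mascheroni constant. There is an absolute constant $C>0$ such that for all integers $n\ge 1$ and $r\ge 1$ with $\sqrt{n\log n}\le r\le n$, \[ P\big(\ell_r(\bar Z)=n\big)=\frac{e^{-\gamma}}{r}\,\rho\Big(\frac nr\Big)\bigg(1+B\,\frac{n\log(n/r+1)}{r^2}\bigg) \] for some real number $B=B(n,r)$ with $|B|\le C$. -/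

import Mathlib

open MeasureTheory ProbabilityTheory

/-- The weighted sum `ℓ_r(s) = 1 s_1 + 2 s_2 + ⋯ + r s_r`. -/
def ell (r : ℕ) (s : ℕ → ℕ) : ℕ := ∑ j ∈ Finset.Icc 1 r, j * s j

/-- `ρ` is a continuous solution on `[0, ∞)` of the difference-differential equation
`u ρ'(u) + ρ(u - 1) = 0` for `u > 1`, with the initial condition `ρ(u) = 1` for `0 ≤ u ≤ 1`. -/
structure IsDickman (ρ : ℝ → ℝ) : Prop where
  continuousOn : ContinuousOn ρ (Set.Ici 0)
  eq_one : ∀ u ∈ Set.Icc (0 : ℝ) 1, ρ u = 1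
  differentiableAt : ∀ u : ℝ, 1 < u → DifferentiableAt ℝ ρ u
  delay_eq : ∀ u : ℝ, 1 < u → u * deriv ρ u + ρ (u - 1) = 0

/-- Successive approximations to the Dickman function: the equation integrated from `1` to `u`.
The `k`-th one is exact on `[0, k + 1]`. -/
noncomputable def dickmanAux : ℕ → ℝ → ℝ
  | 0, _ => 1
  | k + 1, u => 1 - ∫ t in (1 : ℝ)..max 1 u, dickmanAux k (t - 1) / t

/-- The Dickman function on `[0, ∞)` (with the irrelevant value `1` on the negative axis).
See `isDickman_dickman` and `IsDickman.eq_dickman`. -/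
noncomputable def dickman (u : ℝ) : ℝ := dickmanAux ⌊u⌋₊ u

theorem continuousOn_dickmanAux_div {k : ℕ} (h : Continuous (dickmanAux k)) :
    ContinuousOn (fun t : ℝ => dickmanAux k (t - 1) / t) (Set.Ioi 0) :=
  ContinuousOn.div (by fun_prop) continuousOn_id fun _ ht => ne_of_gt ht

theorem hasDerivAt_dickmanAux_integral {k : ℕ} (h : Continuous (dickmanAux k)) {u : ℝ}
    (hu : 0 < u) : HasDerivAt (fun u : ℝ => ∫ t in (1 : ℝ)..u, dickmanAux k (t - 1) / t)
      (dickmanAux k (u - 1) / u) u := by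
  have hc := continuousOn_dickmanAux_div h
  refine intervalIntegral.integral_hasDerivAt_right ?_ ?_ ?_
  · refine (hc.mono ?_).intervalIntegrable
    intro t ht
    exact lt_of_lt_of_le (lt_min one_pos hu) ht.1
  · exact hc.stronglyMeasurableAtFilter isOpen_Ioi u hu
  · exact hc.continuousAt (Ioi_mem_nhds hu)

theorem continuous_dickmanAux (k : ℕ) : Continuous (dickmanAux k) := by
  induction k with
  | zero => exact continuous_const
  | succ k ih =>
    have h : ContinuousOn (fun u : ℝ => ∫ t in (1 : ℝ)..u, dickmanAux k (t - 1) / t)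
        (Set.Ioi 0) := fun u hu =>
      (hasDerivAt_dickmanAux_integral ih hu).continuousAt.continuousWithinAt
    have h2 := h.comp_continuous (f := fun u : ℝ => max 1 u) (by fun_prop)
      fun u => lt_of_lt_of_le one_pos (le_max_left 1 u)
    exact continuous_const.sub h2

theorem dickmanAux_of_le_one (k : ℕ) {u : ℝ} (hu : u ≤ 1) : dickmanAux k u = 1 := by
  cases k with
  | zero => rfl
  | succ k => simp [dickmanAux, max_eq_left hu]

theorem dickmanAux_succ (k : ℕ) : ∀ u : ℝ, u ≤ k + 1 → dickmanAux (k + 1) u = dickmanAux k u := by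
  induction k with
  | zero =>
    intro u hu
    rw [dickmanAux_of_le_one _ (by simpa using hu), dickmanAux_of_le_one _ (by simpa using hu)]
  | succ k ih =>
    intro u hu
    rw [dickmanAux, dickmanAux]
    congr 1
    refine intervalIntegral.integral_congr fun t ht => ?_
    rw [Set.uIcc_of_le (le_max_left 1 u)] at ht
    have h1 : t ≤ k + 2 := ht.2.trans (max_le (by linarith [(Nat.cast_nonneg k : (0 : ℝ) ≤ k)])
      (by push_cast at hu; linarith))
    rw [ih (t - 1) (by linarith)]

theorem dickmanAux_eq_dickman {m : ℕ} {u : ℝ} (hu : u < m + 1) : dickmanAux m u = dickman u := by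
  have hle : ⌊u⌋₊ ≤ m := by
    rcases le_or_gt u 0 with h | h
    · simp [Nat.floor_of_nonpos h]
    · exact Nat.lt_succ_iff.mp ((Nat.floor_lt h.le).mpr (by push_cast; exact hu))
  unfold dickman
  induction m, hle using Nat.le_induction with
  | base => rfl
  | succ m hm ih =>
    have h : u < m + 1 := (Nat.lt_floor_add_one u).trans_le (by
      have : (⌊u⌋₊ : ℝ) ≤ m := by exact_mod_cast hm
      linarith)
    rw [dickmanAux_succ m u h.le, ih h]

theorem dickman_eventuallyEq (u : ℝ) (m : ℕ) (hu : u < m + 1) :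
    dickman =ᶠ[nhds u] dickmanAux m := by
  filter_upwards [Iio_mem_nhds hu] with v hv
  exact (dickmanAux_eq_dickman hv).symm

theorem hasDerivAt_dickman {u : ℝ} (hu : 1 < u) :
    HasDerivAt dickman (-(dickman (u - 1) / u)) u := by
  obtain ⟨m, hm⟩ := exists_nat_gt u
  have h1 := (hasDerivAt_dickmanAux_integral (continuous_dickmanAux m)
    (one_pos.trans hu)).const_sub 1
  rw [dickmanAux_eq_dickman (by linarith)] at h1
  refine h1.congr_of_eventuallyEq ((dickman_eventuallyEq u (m + 1) (by push_cast; linarith)).trans ?_)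
  filter_upwards [Ioi_mem_nhds hu] with v hv
  rw [dickmanAux, max_eq_right (le_of_lt hv)]

/-- The Dickman function solves its defining problem. -/
theorem isDickman_dickman : IsDickman dickman where
  continuousOn := by
    intro u _
    obtain ⟨m, hm⟩ := exists_nat_gt u
    exact ((continuous_dickmanAux m).continuousAt.congr
      (dickman_eventuallyEq u m (by linarith)).symm).continuousWithinAt
  eq_one u hu := dickmanAux_of_le_one _ hu.2
  differentiableAt _ hu := (hasDerivAt_dickman hu).differentiableAt
  delay_eq u hu := by
    rw [(hasDerivAt_dickman hu).deriv]
    field_simp [(one_pos.trans hu).ne']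
    ring

/-- The Dickman function is the only solution. -/
theorem IsDickman.eq_dickman {ρ : ℝ → ℝ} (hρ : IsDickman ρ) {u : ℝ} (hu : 0 ≤ u) :
    ρ u = dickman u := by
  have key : ∀ k : ℕ, ∀ u : ℝ, 0 ≤ u → u ≤ k + 1 → ρ u = dickman u := by
    intro k
    induction k with
    | zero =>
      intro u h0 h1
      rw [hρ.eq_one u ⟨h0, by simpa using h1⟩,
        isDickman_dickman.eq_one u ⟨h0, by simpa using h1⟩]
    | succ k ih =>
      intro u h0 h1
      rcases le_or_gt u 1 with h | h
      · rw [hρ.eq_one u ⟨h0, h⟩, isDickman_dickman.eq_one u ⟨h0, h⟩]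
      · obtain ⟨c, hc, hd⟩ := exists_deriv_eq_slope (fun v => ρ v - dickman v) h
          ((hρ.continuousOn.sub isDickman_dickman.continuousOn).mono
            fun v hv => zero_le_one.trans hv.1)
          fun v hv => ((hρ.differentiableAt v hv.1).sub
            (isDickman_dickman.differentiableAt v hv.1)).differentiableWithinAt
        have hc0 : (0 : ℝ) < c := one_pos.trans hc.1
        have hz : deriv (fun v => ρ v - dickman v) c = 0 := by
          rw [deriv_fun_sub (hρ.differentiableAt c hc.1)
            (isDickman_dickman.differentiableAt c hc.1)]
          have e1 := hρ.delay_eq c hc.1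
          have e2 := isDickman_dickman.delay_eq c hc.1
          have e3 := ih (c - 1) (by linarith [hc.1]) (by have := hc.2; push_cast at h1; linarith)
          have : c * (deriv ρ c - deriv dickman c) = 0 := by linarith
          exact (mul_eq_zero.mp this).resolve_left hc0.ne'
        rw [hz, eq_comm, div_eq_zero_iff] at hd
        have o1 := hρ.eq_one 1 (by norm_num)
        have o2 := isDickman_dickman.eq_one 1 (by norm_num)
        rcases hd with hd | hd <;> linarith
  obtain ⟨m, hm⟩ := exists_nat_gt u
  exact key m u hu (by linarith)

/-! The generating function of `ell r` is `F = exp (∑ j ≤ r, (X ^ j - 1) / j)`, so `X F' = (X + ⋯ +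
X ^ r) F`. Hence its coefficients satisfy `m p(m) = p(m-1) + ⋯ + p(m-r)` for `m ≥ r` and are
constant, equal to `exp (-H_r)`, for `m ≤ r`. This is a discretization, with mesh `1/r`, of `u ρ(u)
= ∫ ρ` over `[u-1, u]` (`integral_dickman`).

The two are compared by induction on `m`. Since `ρ` decreases, left Riemann sums exceed the
integral, so `ρ(m/r)` is a subsolution. The excess is at most `ρ(u-1)`, with `u = m/r`, and
`dickman_sub_one_le_log` bounds it by `O(log (u+1)) u ρ(u)`. A factor `exp (48 L m / r²)`, with `L =
log (n/r + 1)`, absorbs this and gives a supersolution (`sum_dickman_mul_exp_le`).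

At `m = n` this pins `p(n) / (exp (-H_r) ρ(n/r))` between `1` and `exp (48 E)`, where `E = n L /
r²`. The hypothesis on `r` gives `E ≤ 2`, so the exponential is `1 + O(E)`. Replacing `exp (-H_r)`
by `exp (-γ) / r` costs a relative error of at most `1/r ≤ 2E`. -/

/-! ### Integral equation, positivity and monotonicity of `ρ`. -/

theorem dickman_of_le_one {u : ℝ} (hu : u ≤ 1) : dickman u = 1 :=
  dickmanAux_of_le_one _ hu

theorem continuous_dickman : Continuous dickman := by
  refine continuous_iff_continuousAt.mpr fun u => ?_
  obtain ⟨m, hm⟩ := exists_nat_gt u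
  exact (continuous_dickmanAux m).continuousAt.congr (dickman_eventuallyEq u m (by linarith)).symm

theorem intervalIntegrable_dickman (a b : ℝ) : IntervalIntegrable dickman volume a b :=
  continuous_dickman.intervalIntegrable a b

theorem hasDerivAt_integral_dickman (u : ℝ) :
    HasDerivAt (fun u : ℝ => ∫ t in (0 : ℝ)..u, dickman t) (dickman u) u :=
  intervalIntegral.integral_hasDerivAt_right (intervalIntegrable_dickman 0 u)
    (continuous_dickman.stronglyMeasurableAtFilter _ _) continuous_dickman.continuousAt

/-- Both sides have derivative `ρ(u) - ρ(u-1)` for `u > 1`, and both equal `1` at `u = 1`. -/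
theorem integral_dickman {u : ℝ} (hu : 1 ≤ u) :
    ∫ t in (u - 1)..u, dickman t = u * dickman u := by
  have hd (v : ℝ) (hv : 1 < v) : HasDerivAt (fun v : ℝ => v * dickman v -
      ((∫ t in (0 : ℝ)..v, dickman t) - ∫ t in (0 : ℝ)..(v - 1), dickman t)) 0 v := by
    have h1 := (hasDerivAt_id v).mul (hasDerivAt_dickman hv)
    have h2 := (hasDerivAt_integral_dickman (v - 1)).comp_sub_const v 1
    refine (h1.sub ((hasDerivAt_integral_dickman v).sub h2)).congr_deriv ?_
    have : v ≠ 0 := by positivity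
    simp only [id]
    field_simp
    ring
  have hc : Continuous (fun v : ℝ => v * dickman v -
      ((∫ t in (0 : ℝ)..v, dickman t) - ∫ t in (0 : ℝ)..(v - 1), dickman t)) := by
    have hi : Continuous fun v : ℝ => ∫ t in (0 : ℝ)..v, dickman t :=
      continuous_iff_continuousAt.mpr fun v => (hasDerivAt_integral_dickman v).continuousAt
    exact (continuous_id.mul continuous_dickman).sub
      (hi.sub (hi.comp (continuous_id.sub continuous_const)))
  have h01 : ∫ t in (0 : ℝ)..1, dickman t = 1 := by
    rw [intervalIntegral.integral_congr (g := fun _ => (1 : ℝ))]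
    · simp
    · intro t ht
      rw [Set.uIcc_of_le zero_le_one] at ht
      exact dickman_of_le_one ht.2
  have key2 : u * dickman u -
      ((∫ t in (0 : ℝ)..u, dickman t) - ∫ t in (0 : ℝ)..(u - 1), dickman t) = 0 := by
    rcases hu.eq_or_lt with rfl | hu
    · simp [h01, dickman_of_le_one]
    · obtain ⟨c, hc1, hc2⟩ := exists_hasDerivAt_eq_slope _ (fun _ => 0) hu hc.continuousOn
        fun x hx => hd x hx.1
      have hne : u - 1 ≠ 0 := by linarith
      rw [eq_comm, div_eq_zero_iff] at hc2
      have := hc2.resolve_right hne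
      simp only [sub_self, intervalIntegral.integral_same, h01, dickman_of_le_one le_rfl] at this
      linarith
  rw [← intervalIntegral.integral_interval_sub_left (intervalIntegrable_dickman 0 u)
    (intervalIntegrable_dickman 0 (u - 1))]
  linarith

theorem antitoneOn_dickman_of_nonneg {x : ℝ} (h : ∀ u < x, 0 ≤ dickman u) :
    AntitoneOn dickman (Set.Iic (x + 1)) := by
  have h1 : AntitoneOn dickman (Set.Icc 1 (x + 1)) := by
    refine antitoneOn_of_deriv_nonpos (convex_Icc _ _) continuous_dickman.continuousOn ?_ ?_
    · intro v hv
      rw [interior_Icc] at hv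
      exact (hasDerivAt_dickman hv.1).differentiableAt.differentiableWithinAt
    · intro v hv
      rw [interior_Icc] at hv
      rw [(hasDerivAt_dickman hv.1).deriv]
      have h0 := h (v - 1) (by linarith [hv.2])
      have hv0 : 0 < v := one_pos.trans hv.1
      have := div_nonneg h0 hv0.le
      linarith
  intro a ha b hb hab
  simp only [Set.mem_Iic] at ha hb
  rcases le_total b 1 with h | h
  · rw [dickman_of_le_one h, dickman_of_le_one (hab.trans h)]
  · rcases le_total a 1 with h' | h'
    · rw [dickman_of_le_one h', ← dickman_of_le_one le_rfl]
      exact h1 ⟨le_rfl, h.trans hb⟩ ⟨h, hb⟩ h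
    · exact h1 ⟨h', ha⟩ ⟨h, hb⟩ hab

/-- Split the integral equation at `u - 1/2` and bound `ρ` on each half by its value at the right
end. Positivity then propagates in steps of `1/2`. -/
theorem mul_dickman_ge_of_antitoneOn {u : ℝ} (hu : 1 ≤ u) (h : AntitoneOn dickman (Set.Iic u)) :
    dickman (u - 1 / 2) / 2 ≤ (u - 1 / 2) * dickman u := by
  have h1 := integral_dickman hu
  rw [← intervalIntegral.integral_add_adjacent_intervals
    (intervalIntegrable_dickman (u - 1) (u - 1 / 2))
    (intervalIntegrable_dickman (u - 1 / 2) u)] at h1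
  have h2 : ∫ _ in (u - 1)..(u - 1 / 2), dickman (u - 1 / 2) ≤
      ∫ t in (u - 1)..(u - 1 / 2), dickman t := by
    refine intervalIntegral.integral_mono_on (by linarith) (by simp)
      (intervalIntegrable_dickman _ _) fun t ht => ?_
    exact h (Set.mem_Iic.mpr (by linarith [ht.2])) (Set.mem_Iic.mpr (by linarith)) ht.2
  have h3 : ∫ _ in (u - 1 / 2)..u, dickman u ≤ ∫ t in (u - 1 / 2)..u, dickman t := by
    refine intervalIntegral.integral_mono_on (by linarith) (by simp)
      (intervalIntegrable_dickman _ _) fun t ht => ?_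
    exact h (Set.mem_Iic.mpr ht.2) (Set.mem_Iic.mpr le_rfl) ht.2
  simp only [intervalIntegral.integral_const, smul_eq_mul] at h2 h3
  linarith

theorem dickman_pos (u : ℝ) : 0 < dickman u := by
  have key : ∀ k : ℕ, ∀ u : ℝ, u ≤ 1 + k / 2 → 0 < dickman u := by
    intro k
    induction k with
    | zero =>
      intro u hu
      rw [dickman_of_le_one (by simpa using hu)]
      exact one_pos
    | succ k ih =>
      intro u hu
      push_cast at hu
      rcases le_or_gt u 1 with h | h
      · rw [dickman_of_le_one h]
        exact one_pos
      · have h1 := mul_dickman_ge_of_antitoneOn h.le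
          ((antitoneOn_dickman_of_nonneg (x := u - 1) fun v hv =>
            (ih v (by linarith)).le).mono (by simp))
        have h2 := ih (u - 1 / 2) (by linarith)
        have h3 : 0 < (u - 1 / 2) * dickman u := by linarith
        exact (pos_iff_pos_of_mul_pos h3).mp (by linarith)
  obtain ⟨m, hm⟩ := exists_nat_gt (2 * u)
  exact key m u (by linarith)

theorem antitone_dickman : Antitone dickman := fun a b hab =>
  antitoneOn_dickman_of_nonneg (x := b - 1) (fun v _ => (dickman_pos v).le)
    (by simpa using hab) (by simp) hab

/-! ### Logarithmic bound for `-ρ'/ρ`. -/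

/-- This closes the induction in `dickman_sub_one_le`: the growth of the logarithm over a half step,
about `1/(2x)`, pays for the loss `log x / x³`. -/
theorem log_le_one_sub_inv_cube_mul_log {x : ℝ} (hx : 4 ≤ x) :
    Real.log x ≤ (1 - (x ^ 3)⁻¹) * Real.log (x + 1 / 2) := by
  have hx0 : 0 < x := by linarith
  have h1 : 1 / (2 * x + 1) ≤ Real.log (x + 1 / 2) - Real.log x := by
    rw [← Real.log_div (by positivity) (by positivity)]
    refine le_trans (le_of_eq ?_) (Real.one_sub_inv_le_log_of_pos (by positivity))
    field_simp
    ring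
  have h2 : Real.log (x + 1 / 2) ≤ x := by
    have := Real.log_le_sub_one_of_pos (show 0 < x + 1 / 2 by positivity)
    linarith
  have h3 : (x ^ 3)⁻¹ * Real.log (x + 1 / 2) ≤ 1 / (2 * x + 1) := by
    calc (x ^ 3)⁻¹ * Real.log (x + 1 / 2) ≤ (x ^ 3)⁻¹ * x := by gcongr
      _ = 1 / x ^ 2 := by field_simp
      _ ≤ 1 / (2 * x + 1) := by
        apply one_div_le_one_div_of_le (by positivity)
        nlinarith
  linarith

/-- The hypothesis says `-ρ'/ρ ≤ H`, so `ρ(t) ≥ ρ(u-1) exp (-H (t-u+1))` on the left half of the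
window; integrate this in the integral equation. Discarding the right half keeps the hypothesis
below `u - 1/2`, which allows induction by half steps. -/
theorem dickman_sub_one_mul_le {u H : ℝ} (hu : 2 ≤ u) (hH : 0 < H)
    (h : ∀ v, 1 < v → v < u - 1 / 2 → dickman (v - 1) ≤ H * (v * dickman v)) :
    dickman (u - 1) * (1 - Real.exp (-(H / 2))) ≤ H * (u * dickman u) := by
  have hm : MonotoneOn (fun v => dickman v * Real.exp (H * v)) (Set.Icc (u - 1) (u - 1 / 2)) := by
    have hd (v : ℝ) (hv : 1 < v) : HasDerivAt (fun v => dickman v * Real.exp (H * v))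
        (-(dickman (v - 1) / v) * Real.exp (H * v) + dickman v * (Real.exp (H * v) * H)) v := by
      have := ((hasDerivAt_id v).const_mul H).exp
      simp only [id, mul_one] at this
      exact (hasDerivAt_dickman hv).mul this
    refine monotoneOn_of_deriv_nonneg (convex_Icc _ _) ?_ ?_ ?_
    · exact (continuous_dickman.mul (by fun_prop)).continuousOn
    · intro v hv
      rw [interior_Icc] at hv
      exact (hd v (by linarith [hv.1])).differentiableAt.differentiableWithinAt
    · intro v hv
      rw [interior_Icc] at hv
      have hv1 : 1 < v := by linarith [hv.1]
      rw [(hd v hv1).deriv]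
      have h1 : dickman (v - 1) / v ≤ H * dickman v := by
        rw [div_le_iff₀ (by linarith)]
        linarith [h v hv1 hv.2]
      have := mul_nonneg (sub_nonneg.mpr h1) (Real.exp_pos (H * v)).le
      linarith
  have hexp : ∫ t in (u - 1)..(u - 1 / 2), Real.exp (H * (u - 1) - H * t) =
      (1 - Real.exp (-(H / 2))) / H := by
    have hd (t : ℝ) : HasDerivAt (fun t => -Real.exp (H * (u - 1) - H * t) / H)
        (Real.exp (H * (u - 1) - H * t)) t := by
      have := ((((hasDerivAt_id t).const_mul H).const_sub (H * (u - 1))).exp).neg.div_const H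
      refine this.congr_deriv ?_
      simp only [id]
      field_simp
    rw [intervalIntegral.integral_eq_sub_of_hasDerivAt (fun t _ => hd t)
      (Continuous.intervalIntegrable (by fun_prop) _ _)]
    rw [show H * (u - 1) - H * (u - 1 / 2) = -(H / 2) by ring, sub_self, Real.exp_zero]
    ring
  have h1 : dickman (u - 1) * ((1 - Real.exp (-(H / 2))) / H) ≤
      ∫ t in (u - 1)..(u - 1 / 2), dickman t := by
    rw [← hexp, ← intervalIntegral.integral_const_mul]
    refine intervalIntegral.integral_mono_on (by linarith)
      (Continuous.intervalIntegrable (by fun_prop) _ _) (intervalIntegrable_dickman _ _)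
      fun t ht => ?_
    have := hm ⟨le_rfl, by linarith⟩ ht ht.1
    simp only at this
    rw [Real.exp_sub, ← mul_div_assoc, div_le_iff₀ (Real.exp_pos _)]
    exact this
  have h2 : ∫ t in (u - 1)..(u - 1 / 2), dickman t ≤ u * dickman u := by
    rw [← integral_dickman (by linarith : 1 ≤ u),
      ← intervalIntegral.integral_add_adjacent_intervals
        (intervalIntegrable_dickman (u - 1) (u - 1 / 2))
        (intervalIntegrable_dickman (u - 1 / 2) u)]
    have : 0 ≤ ∫ t in (u - 1 / 2)..u, dickman t :=
      intervalIntegral.integral_nonneg (by linarith) fun t _ => (dickman_pos t).le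
    linarith
  have h3 := h1.trans h2
  rw [← mul_div_assoc, div_le_iff₀ hH] at h3
  linarith

theorem one_sixth_le_dickman {u : ℝ} (hu : u ≤ 2) : 1 / 6 ≤ dickman u := by
  have h1 := mul_dickman_ge_of_antitoneOn (u := 3 / 2) (by norm_num) (antitone_dickman.antitoneOn _)
  have h2 := mul_dickman_ge_of_antitoneOn (u := 2) (by norm_num) (antitone_dickman.antitoneOn _)
  have h3 := antitone_dickman hu
  norm_num at h1 h2
  rw [dickman_of_le_one le_rfl] at h1
  linarith

/-- The logarithmic derivative of the Dickman function grows at most logarithmically. -/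
theorem dickman_sub_one_le {u : ℝ} (hu : 1 ≤ u) :
    dickman (u - 1) ≤ 6 * Real.log (u + 3) * (u * dickman u) := by
  have key : ∀ k : ℕ, ∀ u : ℝ, 1 ≤ u → u ≤ 2 + k / 2 →
      dickman (u - 1) ≤ 6 * Real.log (u + 3) * (u * dickman u) := by
    have base (u : ℝ) (h1 : 1 ≤ u) (h2 : u ≤ 2) :
        dickman (u - 1) ≤ 6 * Real.log (u + 3) * (u * dickman u) := by
      rw [dickman_of_le_one (by linarith)]
      have hl : 1 ≤ Real.log (u + 3) := by
        rw [Real.le_log_iff_exp_le (by linarith)]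
        linarith [Real.exp_one_lt_d9]
      have h3 := one_sixth_le_dickman h2
      have h4 : 1 / 6 ≤ u * dickman u := by nlinarith
      nlinarith
    intro k
    induction k with
    | zero => exact fun u h1 h2 => base u h1 (by simpa using h2)
    | succ k ih =>
      intro u h1 h2
      push_cast at h2
      rcases le_or_gt u 2 with h | h
      · exact base u h1 h
      · have hx : 4 ≤ u + 5 / 2 := by linarith
        have hlog : 0 < Real.log (u + 5 / 2) := Real.log_pos (by linarith)
        have h3 := dickman_sub_one_mul_le (H := 6 * Real.log (u + 5 / 2)) h.le (by positivity)
          fun v hv1 hv2 => (ih v hv1.le (by linarith)).trans (by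
            have := dickman_pos v
            have hv0 : 0 < v := by linarith
            have : Real.log (v + 3) ≤ Real.log (u + 5 / 2) :=
              Real.log_le_log (by linarith) (by linarith)
            gcongr)
        -- The factor `6` makes the loss exactly the inverse cube handled by
        -- `log_le_one_sub_inv_cube_mul_log`.
        have he : Real.exp (-(6 * Real.log (u + 5 / 2) / 2)) = ((u + 5 / 2) ^ 3)⁻¹ := by
          rw [Real.exp_neg, show 6 * Real.log (u + 5 / 2) / 2 = (3 : ℕ) * Real.log (u + 5 / 2) by
            push_cast; ring, Real.exp_nat_mul, Real.exp_log (by linarith)]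
        rw [he] at h3
        have h4 := log_le_one_sub_inv_cube_mul_log hx
        rw [show u + 5 / 2 + 1 / 2 = u + 3 by ring] at h4
        have hp : 0 < 1 - ((u + 5 / 2) ^ 3)⁻¹ := by
          have : ((u + 5 / 2) ^ 3)⁻¹ < 1 := inv_lt_one_of_one_lt₀ (one_lt_pow₀ (by linarith) (by norm_num))
          linarith
        have hr : 0 ≤ u * dickman u := mul_nonneg (by linarith) (dickman_pos u).le
        have h5 := mul_le_mul_of_nonneg_right h4 hr
        refine le_of_mul_le_mul_right (h3.trans ?_) hp
        linarith
  obtain ⟨m, hm⟩ := exists_nat_gt (2 * u)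
  exact key m u hu (by linarith)

theorem dickman_sub_one_le_log {u : ℝ} (hu : 1 ≤ u) :
    dickman (u - 1) ≤ 12 * Real.log (u + 1) * (u * dickman u) := by
  refine (dickman_sub_one_le hu).trans ?_
  have h : Real.log (u + 3) ≤ 2 * Real.log (u + 1) := by
    rw [show 2 * Real.log (u + 1) = Real.log ((u + 1) ^ 2) by rw [Real.log_pow]; norm_num]
    exact Real.log_le_log (by linarith) (by nlinarith)
  have hr : 0 ≤ u * dickman u := mul_nonneg (by linarith) (dickman_pos u).le
  nlinarith

/-! ### Riemann sums of `ρ` with mesh `1/r`. -/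

theorem integral_dickman_div {r m : ℕ} (hr : 0 < r) (hm : r ≤ m) :
    ∫ s in ((m - r : ℕ) : ℝ)..((m - r : ℕ) : ℝ) + r, dickman (s / r) =
      m * dickman (m / r) := by
  have hr0 : (0 : ℝ) < r := by exact_mod_cast hr
  have hm' : (r : ℝ) ≤ m := by exact_mod_cast hm
  rw [intervalIntegral.integral_comp_div _ hr0.ne', Nat.cast_sub hm,
    show ((m : ℝ) - r) / r = m / r - 1 by field_simp, show ((m : ℝ) - r + r) / r = m / r by ring,
    integral_dickman ((one_le_div hr0).mpr hm'), smul_eq_mul]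
  field_simp

theorem antitone_dickman_div {r : ℕ} : Antitone fun s : ℝ => dickman (s / r) :=
  antitone_dickman.comp_monotone fun _ _ h => div_le_div_of_nonneg_right h (Nat.cast_nonneg r)

theorem mul_dickman_le_sum {r m : ℕ} (hr : 0 < r) (hm : r ≤ m) :
    m * dickman (m / r) ≤ ∑ i ∈ Finset.range r, dickman ((m - r + i : ℕ) / r) := by
  rw [← integral_dickman_div hr hm]
  refine (AntitoneOn.integral_le_sum (antitone_dickman_div.antitoneOn _)).trans_eq ?_
  simp

/-- The right Riemann sum is at most the integral, and the left one exceeds it by `ρ(m/r - 1) -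
ρ(m/r)`. -/
theorem sum_dickman_le {r m : ℕ} (hr : 0 < r) (hm : r ≤ m) :
    ∑ i ∈ Finset.range r, dickman ((m - r + i : ℕ) / r) ≤
      m * dickman (m / r) * (1 + 12 * Real.log (m / r + 1) / r) := by
  have hr0 : (0 : ℝ) < r := by exact_mod_cast hr
  have hm' : (r : ℝ) ≤ m := by exact_mod_cast hm
  have h1 := AntitoneOn.sum_le_integral (x₀ := ((m - r : ℕ) : ℝ)) (a := r)
    ((antitone_dickman_div (r := r)).antitoneOn _)
  rw [integral_dickman_div hr hm] at h1
  have h2 := Finset.sum_range_succ_sub_sum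
    (fun i : ℕ => dickman ((m - r + i : ℕ) / r)) (n := r)
  have h3 := Finset.sum_range_succ' (fun i : ℕ => dickman ((m - r + i : ℕ) / r)) r
  have h4 : ∑ i ∈ Finset.range r, dickman ((((m - r : ℕ) : ℝ) + (i + 1 : ℕ)) / r) =
      ∑ i ∈ Finset.range r, dickman ((m - r + (i + 1) : ℕ) / r) := by
    simp
  have h5 := dickman_sub_one_le_log ((one_le_div hr0).mpr hm')
  have h6 : dickman ((m - r + 0 : ℕ) / r) = dickman (m / r - 1) := by
    rw [add_zero, Nat.cast_sub hm, sub_div, div_self hr0.ne']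
  have h7 : 0 < dickman ((m - r + r : ℕ) / r) := dickman_pos _
  have h8 : m * dickman (m / r) * (1 + 12 * Real.log (m / r + 1) / r) =
      m * dickman (m / r) + 12 * Real.log (m / r + 1) * (m / r * dickman (m / r)) := by
    field_simp
  rw [h8]
  linarith

theorem sum_exp_mul_le {lam : ℝ} (hlam : 0 < lam) (k r : ℕ) :
    ∑ i ∈ Finset.range r, Real.exp (lam * (k + i : ℕ)) ≤
      Real.exp (lam * (k + r : ℕ)) * ((1 - Real.exp (-(lam * r))) / lam) := by
  have h1 : ∑ i ∈ Finset.range r, Real.exp (lam * (k + i : ℕ)) * lam ≤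
      ∑ i ∈ Finset.range r,
        (Real.exp (lam * (k + (i + 1) : ℕ)) - Real.exp (lam * (k + i : ℕ))) := by
    refine Finset.sum_le_sum fun i _ => ?_
    have : Real.exp (lam * (k + (i + 1) : ℕ)) = Real.exp (lam * (k + i : ℕ)) * Real.exp lam := by
      rw [← Real.exp_add]
      push_cast
      ring_nf
    have h2 := Real.add_one_le_exp lam
    have h3 := Real.exp_pos (lam * (k + i : ℕ))
    rw [this]
    nlinarith
  rw [Finset.sum_range_sub (fun i => Real.exp (lam * (k + i : ℕ))), ← Finset.sum_mul] at h1
  rw [← mul_div_assoc, le_div_iff₀ hlam, mul_sub, ← Real.exp_add, mul_one]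
  refine h1.trans (le_of_eq ?_)
  push_cast
  ring_nf

/-- For `t ≤ 1/2`, `exp (-4t) ≥ (1-2t)²` bounds the left side by `4t (1-t²)`; for larger `t`,
already `1 + t ≤ 4t`. -/
theorem one_add_mul_one_sub_exp_le {t : ℝ} (ht : 0 ≤ t) :
    (1 + t) * (1 - Real.exp (-(4 * t))) ≤ 4 * t := by
  rcases le_total (2 * t) 1 with h | h
  · have h1 := Real.add_one_le_exp (-(2 * t))
    have h2 : Real.exp (-(4 * t)) = Real.exp (-(2 * t)) ^ 2 := by
      rw [← Real.exp_nat_mul]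
      push_cast
      ring_nf
    have h3 : (1 - 2 * t) ^ 2 ≤ Real.exp (-(4 * t)) := by
      rw [h2]
      exact pow_le_pow_left₀ (by linarith) (by linarith) 2
    nlinarith [pow_nonneg ht 3]
  · have := Real.exp_pos (-(4 * t))
    nlinarith

/-- Chebyshev's sum inequality for oppositely monotone sequences separates `ρ` from the exponential.
With `t = 12 L / r`, the `ρ` sum loses a factor `1 + t` and the exponential sum gains `(1 - exp
(-4t)) / (4t)`; the rate `48 L / r²` is chosen so that the gain wins. -/
theorem sum_dickman_mul_exp_le {r m : ℕ} (hr : 0 < r) (hm : r ≤ m) {L : ℝ} (hL : 0 < L)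
    (hmL : Real.log (m / r + 1) ≤ L) :
    ∑ i ∈ Finset.range r, dickman ((m - r + i : ℕ) / r) *
        Real.exp (48 * L / r ^ 2 * (m - r + i : ℕ)) ≤
      m * (dickman (m / r) * Real.exp (48 * L / r ^ 2 * m)) := by
  have hr0 : (0 : ℝ) < r := by exact_mod_cast hr
  set lam := 48 * L / r ^ 2 with hlam
  have hlam0 : 0 < lam := by positivity
  have h1 : AntivaryOn (fun i : ℕ => dickman ((m - r + i : ℕ) / r))
      (fun i : ℕ => Real.exp (lam * (m - r + i : ℕ))) (Finset.range r) := by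
    refine Antivary.antivaryOn (Antitone.antivary ?_ ?_) _
    · intro i j hij
      exact antitone_dickman_div (r := r) (by simpa using hij)
    · intro i j hij
      have : ((m - r + i : ℕ) : ℝ) ≤ (m - r + j : ℕ) := by exact_mod_cast by omega
      exact Real.exp_le_exp.mpr (by gcongr)
  have h2 := h1.card_mul_sum_le_sum_mul_sum
  rw [Finset.card_range] at h2
  have h3 := sum_exp_mul_le hlam0 (m - r) r
  rw [Nat.sub_add_cancel hm] at h3
  have h4 := sum_dickman_le hr hm
  have hd := dickman_pos (m / r)
  have h5 : ∑ i ∈ Finset.range r, dickman ((m - r + i : ℕ) / r) ≤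
      m * dickman (m / r) * (1 + 12 * L / r) := h4.trans (by gcongr)
  have hx : lam * r = 4 * (12 * L / r) := by
    rw [hlam]
    field_simp
    ring
  have h6 := one_add_mul_one_sub_exp_le (t := 12 * L / r) (by positivity)
  rw [← hx] at h6
  refine le_of_mul_le_mul_left (h2.trans ?_) hr0
  refine (mul_le_mul h5 h3 (Finset.sum_nonneg fun i _ => (Real.exp_pos _).le)
    (by positivity)).trans ?_
  have h7 : (1 + 12 * L / r) * ((1 - Real.exp (-(lam * r))) / lam) ≤ r := by
    rw [← mul_div_assoc, div_le_iff₀ hlam0]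
    linarith
  calc m * dickman (m / r) * (1 + 12 * L / r) *
        (Real.exp (lam * m) * ((1 - Real.exp (-(lam * r))) / lam))
      = m * (dickman (m / r) * Real.exp (lam * m)) *
        ((1 + 12 * L / r) * ((1 - Real.exp (-(lam * r))) / lam)) := by ring
    _ ≤ m * (dickman (m / r) * Real.exp (lam * m)) * r := by gcongr
    _ = _ := by ring

/-! ### Comparison of the recurrence with `ρ`. -/

theorem dickman_le_of_recurrence {r : ℕ} (hr : 0 < r) {b : ℕ → ℝ} (h1 : ∀ m ≤ r, b m = 1)
    (hrec : ∀ m, r < m → m * b m = ∑ i ∈ Finset.range r, b (m - r + i)) (m : ℕ) :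
    dickman (m / r) ≤ b m := by
  induction m using Nat.strong_induction_on with
  | _ m ih =>
    have hr0 : (0 : ℝ) < r := by exact_mod_cast hr
    rcases le_or_gt m r with h | h
    · rw [h1 m h, dickman_of_le_one]
      exact (div_le_one hr0).mpr (by exact_mod_cast h)
    · have hm0 : (0 : ℝ) < m := by exact_mod_cast hr.trans h
      refine le_of_mul_le_mul_left ?_ hm0
      rw [hrec m h]
      refine (mul_dickman_le_sum hr h.le).trans (Finset.sum_le_sum fun i hi => ?_)
      exact ih _ (by rw [Finset.mem_range] at hi; omega)

theorem le_dickman_mul_exp_of_recurrence {r n : ℕ} (hr : 0 < r) {b : ℕ → ℝ}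
    (h1 : ∀ m ≤ r, b m = 1)
    (hrec : ∀ m, r < m → m * b m = ∑ i ∈ Finset.range r, b (m - r + i)) {L : ℝ} (hL : 0 < L)
    (hnL : Real.log (n / r + 1) ≤ L) {m : ℕ} (hmn : m ≤ n) :
    b m ≤ dickman (m / r) * Real.exp (48 * L / r ^ 2 * m) := by
  induction m using Nat.strong_induction_on with
  | _ m ih =>
    have hr0 : (0 : ℝ) < r := by exact_mod_cast hr
    rcases le_or_gt m r with h | h
    · rw [h1 m h, dickman_of_le_one, one_mul]
      · exact Real.one_le_exp (by positivity)
      · exact (div_le_one hr0).mpr (by exact_mod_cast h)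
    · have hm0 : (0 : ℝ) < m := by exact_mod_cast hr.trans h
      refine le_of_mul_le_mul_left ?_ hm0
      rw [hrec m h]
      have hmL : Real.log (m / r + 1) ≤ L := by
        refine le_trans (Real.log_le_log (by positivity) ?_) hnL
        gcongr
      refine le_trans (Finset.sum_le_sum fun i hi => ?_) (sum_dickman_mul_exp_le hr h.le hL hmL)
      rw [Finset.mem_range] at hi
      exact ih _ (by omega) (by omega)

/-! ### Generating functions and the recurrence for their coefficients. -/

/-- The generating function of `j Z` for a Poisson variable `Z` of mean `1 / j`. -/
noncomputable def poissonSeries (j : ℕ) : PowerSeries ℝ :=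
  PowerSeries.mk fun m => if j ∣ m then
    Real.exp (-(1 / (j : ℝ))) * (1 / (j : ℝ)) ^ (m / j) / (m / j).factorial else 0

/-- The series is `exp ((X ^ j - 1) / j)`; the identity is checked on coefficients. -/
theorem X_mul_derivative_poissonSeries {j : ℕ} (hj : 0 < j) :
    PowerSeries.X * PowerSeries.derivative ℝ (poissonSeries j) =
      PowerSeries.X ^ j * poissonSeries j := by
  have hj0 : (j : ℝ) ≠ 0 := by exact_mod_cast hj.ne'
  ext m
  rw [PowerSeries.coeff_X_pow_mul']
  cases m with
  | zero => simp [hj.ne']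
  | succ m =>
    rw [PowerSeries.coeff_succ_X_mul, PowerSeries.coeff_derivative]
    simp only [poissonSeries, PowerSeries.coeff_mk]
    by_cases hd : j ∣ m + 1
    · obtain ⟨k, hk⟩ := hd
      cases k with
      | zero => simp at hk
      | succ k =>
        have hle : j ≤ m + 1 := by rw [hk]; exact Nat.le_mul_of_pos_right _ (by omega)
        have hs : m + 1 - j = j * k := by rw [hk, mul_add, mul_one, Nat.add_sub_cancel]
        have hc : (m : ℝ) + 1 = j * (k + 1) := by exact_mod_cast hk
        rw [if_pos hle, hs, hk, if_pos (dvd_mul_right _ _), if_pos (dvd_mul_right _ _),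
          Nat.mul_div_cancel_left _ hj, Nat.mul_div_cancel_left _ hj, Nat.factorial_succ, hc]
        push_cast
        rw [pow_succ]
        field_simp
    · rw [if_neg hd, zero_mul]
      split_ifs with h1 h2
      · exact absurd ((Nat.dvd_sub_iff_left h1 dvd_rfl).mp h2) hd
      · rfl
      · rfl

/-- The generating function of `1 Z_1 + ⋯ + r Z_r`. -/
noncomputable def ellSeries (r : ℕ) : PowerSeries ℝ := ∏ j ∈ Finset.Icc 1 r, poissonSeries j

theorem ellSeries_succ (r : ℕ) : ellSeries (r + 1) = ellSeries r * poissonSeries (r + 1) :=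
  Finset.prod_Icc_succ_top (by omega) _

theorem X_mul_derivative_ellSeries (r : ℕ) :
    PowerSeries.X * PowerSeries.derivative ℝ (ellSeries r) =
      (∑ j ∈ Finset.Icc 1 r, PowerSeries.X ^ j) * ellSeries r := by
  induction r with
  | zero => simp [ellSeries]
  | succ r ih =>
    rw [ellSeries_succ, Derivation.leibniz, Finset.sum_Icc_succ_top (by omega), smul_eq_mul,
      smul_eq_mul]
    have h := X_mul_derivative_poissonSeries (Nat.succ_pos r)
    rw [Nat.succ_eq_add_one] at h
    linear_combination ellSeries r * h + poissonSeries (r + 1) * ih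

theorem coeff_zero_ellSeries (r : ℕ) :
    PowerSeries.coeff 0 (ellSeries r) = Real.exp (-(harmonic r : ℝ)) := by
  induction r with
  | zero => simp [ellSeries]
  | succ r ih =>
    rw [ellSeries_succ, PowerSeries.coeff_mul, Finset.Nat.antidiagonal_zero, Finset.sum_singleton, ih, harmonic_succ]
    simp only [poissonSeries, PowerSeries.coeff_mk]
    push_cast
    rw [neg_add, Real.exp_add]
    simp

theorem mul_coeff_ellSeries (r m : ℕ) :
    m * PowerSeries.coeff m (ellSeries r) =
      ∑ j ∈ Finset.Icc 1 r, if j ≤ m then PowerSeries.coeff (m - j) (ellSeries r) else 0 := by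
  have h := congrArg (PowerSeries.coeff m) (X_mul_derivative_ellSeries r)
  simp only [Finset.sum_mul, map_sum, PowerSeries.coeff_X_pow_mul'] at h
  rw [← h]
  cases m with
  | zero => simp
  | succ m =>
    rw [PowerSeries.coeff_succ_X_mul, PowerSeries.coeff_derivative]
    push_cast
    ring

theorem mul_coeff_ellSeries_of_le {r m : ℕ} (h : r ≤ m) :
    m * PowerSeries.coeff m (ellSeries r) =
      ∑ i ∈ Finset.range r, PowerSeries.coeff (m - r + i) (ellSeries r) := by
  rw [mul_coeff_ellSeries]
  refine Finset.sum_bij' (fun j _ => r - j) (fun i _ => r - i) ?_ ?_ ?_ ?_ ?_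
  · intro j hj
    simp only [Finset.mem_Icc, Finset.mem_range] at *
    omega
  · intro j hj
    simp only [Finset.mem_Icc, Finset.mem_range] at *
    omega
  · intro j hj
    simp only [Finset.mem_Icc] at hj
    omega
  · intro j hj
    simp only [Finset.mem_range] at hj
    omega
  · intro j hj
    simp only [Finset.mem_Icc] at hj
    rw [if_pos (by omega)]
    congr 2
    omega

/-- For `m ≤ r` the recurrence makes each coefficient the mean of all earlier ones. -/
theorem coeff_ellSeries_of_le {r m : ℕ} (h : m ≤ r) :
    PowerSeries.coeff m (ellSeries r) = PowerSeries.coeff 0 (ellSeries r) := by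
  induction m using Nat.strong_induction_on with
  | _ m ih =>
    rcases Nat.eq_zero_or_pos m with rfl | hm
    · rfl
    · have hm0 : (m : ℝ) ≠ 0 := by exact_mod_cast hm.ne'
      refine mul_left_cancel₀ hm0 ?_
      rw [mul_coeff_ellSeries, ← Finset.sum_filter,
        Finset.sum_congr rfl (g := fun _ => PowerSeries.coeff 0 (ellSeries r))]
      · have : Finset.filter (fun j => j ≤ m) (Finset.Icc 1 r) = Finset.Icc 1 m := by
          ext j
          simp only [Finset.mem_filter, Finset.mem_Icc]
          omega
        rw [this]
        simp
      · intro j hj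
        simp only [Finset.mem_filter, Finset.mem_Icc] at hj
        exact ih (m - j) (by omega) (by omega)

/-! ### The law of `ell r` as coefficients of `ellSeries r`. -/

theorem measureReal_add_eq {Ω : Type*} [MeasurableSpace Ω] {P : Measure Ω} [IsProbabilityMeasure P]
    {X Y : Ω → ℕ} (hX : Measurable X) (hY : Measurable Y) (h : IndepFun X Y P) (n : ℕ) :
    P.real {ω | X ω + Y ω = n} =
      ∑ p ∈ Finset.HasAntidiagonal.antidiagonal n, P.real {ω | X ω = p.1} * P.real {ω | Y ω = p.2} := by
  have hset : {ω | X ω + Y ω = n} =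
      ⋃ p ∈ Finset.HasAntidiagonal.antidiagonal n, (X ⁻¹' {p.1} ∩ Y ⁻¹' {p.2}) := by
    ext ω
    simp only [Set.mem_ofPred_eq, Set.mem_iUnion, Finset.HasAntidiagonal.mem_antidiagonal, Set.mem_inter_iff,
      Set.mem_preimage, Set.mem_singleton_iff, exists_prop, Prod.exists]
    exact ⟨fun h => ⟨_, _, h, rfl, rfl⟩, fun ⟨a, b, h, ha, hb⟩ => by rw [ha, hb, h]⟩
  rw [hset, measureReal_biUnion_finset]
  · refine Finset.sum_congr rfl fun p _ => ?_
    rw [measureReal_def, h.measure_inter_preimage_eq_mul _ _ (MeasurableSet.singleton _)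
      (MeasurableSet.singleton _), ENNReal.toReal_mul]
    rfl
  · intro p _ q _ hpq
    refine Set.disjoint_left.mpr fun ω hp hq => hpq ?_
    exact Prod.ext (hp.1.symm.trans hq.1) (hp.2.symm.trans hq.2)
  · exact fun p _ => (hX (MeasurableSet.singleton _)).inter (hY (MeasurableSet.singleton _))

theorem measureReal_mul_poisson_eq {Ω : Type*} [MeasurableSpace Ω] {P : Measure Ω}
    {X : Ω → ℕ} {j : ℕ} (hj : 0 < j) (hX : HasLaw X (poissonMeasure (1 / (j : NNReal))) P) (m : ℕ) :
    P.real {ω | j * X ω = m} = PowerSeries.coeff m (poissonSeries j) := by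
  simp only [poissonSeries, PowerSeries.coeff_mk]
  split_ifs with hd
  · obtain ⟨k, rfl⟩ := hd
    rw [Nat.mul_div_cancel_left _ hj]
    have : {ω | j * X ω = j * k} = X ⁻¹' {k} := by
      ext ω
      simp [hj.ne']
    rw [this, ← map_measureReal_apply_of_aemeasurable hX.aemeasurable (MeasurableSet.singleton _),
      hX.map_eq, poissonMeasure_real_singleton]
    simp
  · have : {ω | j * X ω = m} = ∅ := by
      ext ω
      simp only [Set.mem_ofPred_eq, Set.mem_empty_iff_false, iff_false]
      exact fun h => hd ⟨_, h.symm⟩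
    rw [this, measureReal_empty]

theorem measureReal_ell_eq_of_measurable {Ω : Type*} [MeasurableSpace Ω] {P : Measure Ω}
    [IsProbabilityMeasure P] {n : ℕ} {Z : ℕ → Ω → ℕ} (hm : ∀ j, Measurable (Z j))
    (hZ : ∀ j ∈ Finset.Icc 1 n, HasLaw (Z j) (poissonMeasure (1 / (j : NNReal))) P)
    (hi : iIndepFun (fun j : Finset.Icc 1 n => Z j) P) {r : ℕ} (hr : r ≤ n) (m : ℕ) :
    P.real {ω | ell r (fun j => Z j ω) = m} = PowerSeries.coeff m (ellSeries r) := by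
  induction r generalizing m with
  | zero =>
    rw [ellSeries]
    by_cases h : m = 0
    · simp [ell, h]
    · simp [ell, h, Ne.symm h, PowerSeries.coeff_one]
  | succ r ih =>
    have hind : IndepFun (fun ω => ell r fun j => Z j ω) (fun ω => (r + 1) * Z (r + 1) ω) P := by
      have h1 := hi.comp (fun j k => (j : ℕ) * k) fun j => measurable_from_nat
      have hmem : r + 1 ∈ Finset.Icc 1 n := Finset.mem_Icc.mpr ⟨by omega, hr⟩
      have h2 := h1.indepFun_finsetSum_of_notMem
        (fun j => measurable_from_nat.comp (hm j))
        (s := (Finset.Icc 1 r).subtype (· ∈ Finset.Icc 1 n)) (i := ⟨r + 1, hmem⟩) (by simp)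
      refine h2.congr (Filter.Eventually.of_forall fun ω => ?_) Filter.EventuallyEq.rfl
      rw [Finset.sum_apply]
      change _ = ∑ j ∈ Finset.Icc 1 r, j * Z j ω
      -- Independence is indexed by the subtype of `Finset.Icc 1 n`, so the partial sum is carried
      -- back from there.
      have := Finset.sum_subtype_of_mem (s := Finset.Icc 1 r) (p := (· ∈ Finset.Icc 1 n))
        (fun j => j * Z j ω) (fun j hj => by
          simp only [Finset.mem_Icc] at hj ⊢
          omega)
      exact this
    have hell : Measurable fun ω => ell r fun j => Z j ω := by
      unfold ell
      exact Finset.measurable_sum _ fun j _ => (hm j).const_mul _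
    have hs : {ω | ell (r + 1) (fun j => Z j ω) = m} =
        {ω | (ell r fun j => Z j ω) + (r + 1) * Z (r + 1) ω = m} := by
      simp only [ell, Finset.sum_Icc_succ_top (show 1 ≤ r + 1 by omega)]
    rw [hs, measureReal_add_eq hell ((hm _).const_mul _) hind, ellSeries_succ,
      PowerSeries.coeff_mul]
    refine Finset.sum_congr rfl fun p _ => ?_
    rw [ih (by omega), measureReal_mul_poisson_eq (Nat.succ_pos r)
      (hZ _ (Finset.mem_Icc.mpr ⟨by omega, hr⟩))]

theorem measureReal_ell_eq {Ω : Type*} [MeasurableSpace Ω] {P : Measure Ω}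
    [IsProbabilityMeasure P] {n : ℕ} {Z : ℕ → Ω → ℕ}
    (hZ : ∀ j ∈ Finset.Icc 1 n, HasLaw (Z j) (poissonMeasure (1 / (j : NNReal))) P)
    (hi : iIndepFun (fun j : Finset.Icc 1 n => Z j) P) {r : ℕ} (hr : r ≤ n) (m : ℕ) :
    P.real {ω | ell r (fun j => Z j ω) = m} = PowerSeries.coeff m (ellSeries r) := by
  classical
  -- `HasLaw` gives only a.e. measurability, so each variable is replaced by a measurable
  -- modification.
  let Y : ℕ → Ω → ℕ := fun j =>
    if h : j ∈ Finset.Icc 1 n then (hZ j h).aemeasurable.mk (Z j) else fun _ => 0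
  have hY : ∀ j, Measurable (Y j) := by
    intro j
    by_cases h : j ∈ Finset.Icc 1 n
    · simp only [Y, dif_pos h]
      exact (hZ j h).aemeasurable.measurable_mk
    · simp only [Y, dif_neg h]
      exact measurable_const
  have hae : ∀ j ∈ Finset.Icc 1 n, Z j =ᵐ[P] Y j := by
    intro j h
    simp only [Y, dif_pos h]
    exact (hZ j h).aemeasurable.ae_eq_mk
  rw [← measureReal_ell_eq_of_measurable hY (fun j h => (hZ j h).congr (hae j h).symm)
    (hi.congr fun j => hae j j.2) hr m]
  refine measureReal_congr ?_
  have hall : ∀ᵐ ω ∂P, ∀ j ∈ Finset.Icc 1 n, Z j ω = Y j ω :=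
    (Finset.eventually_all _).mpr hae
  filter_upwards [hall] with ω hω
  have : ell r (fun j => Z j ω) = ell r fun j => Y j ω := by
    unfold ell
    refine Finset.sum_congr rfl fun j hj => congrArg (j * ·) ?_
    exact hω j (Finset.mem_Icc.mpr ⟨(Finset.mem_Icc.mp hj).1, (Finset.mem_Icc.mp hj).2.trans hr⟩)
  exact congrArg (· = m) this

/-! ### Euler's constant, size of the error term, and conclusion. -/

theorem exp_neg_harmonic_le {r : ℕ} (hr : 0 < r) :
    Real.exp (-(harmonic r : ℝ)) ≤ Real.exp (-Real.eulerMascheroniConstant) / r := by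
  have hr0 : (0 : ℝ) < r := by exact_mod_cast hr
  have h := Real.eulerMascheroniConstant_lt_eulerMascheroniSeq' r
  rw [Real.eulerMascheroniSeq', if_neg hr.ne'] at h
  rw [le_div_iff₀ hr0, ← Real.exp_log hr0, ← Real.exp_add, Real.exp_le_exp]
  linarith

theorem le_exp_neg_harmonic {r : ℕ} (hr : 0 < r) :
    Real.exp (-Real.eulerMascheroniConstant) / r * (1 - 1 / r) ≤ Real.exp (-(harmonic r : ℝ)) := by
  have hr0 : (0 : ℝ) < r := by exact_mod_cast hr
  have h := Real.eulerMascheroniSeq_lt_eulerMascheroniConstant r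
  rw [Real.eulerMascheroniSeq] at h
  have h1 : Real.log (r + 1) ≤ Real.log r + 1 / r := by
    have h2 := Real.log_le_sub_one_of_pos (show 0 < ((r : ℝ) + 1) / r by positivity)
    rw [Real.log_div (by positivity) hr0.ne', add_div, div_self hr0.ne'] at h2
    linarith
  have h3 := Real.add_one_le_exp (-(1 / (r : ℝ)))
  calc Real.exp (-Real.eulerMascheroniConstant) / r * (1 - 1 / r)
      ≤ Real.exp (-Real.eulerMascheroniConstant) / r * Real.exp (-(1 / (r : ℝ))) := by
        gcongr
        linarith
    _ = Real.exp (-Real.eulerMascheroniConstant - Real.log r - 1 / r) := by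
        rw [Real.exp_sub, Real.exp_sub, Real.exp_log hr0, Real.exp_neg (1 / (r : ℝ))]
        field_simp
    _ ≤ _ := by
        rw [Real.exp_le_exp]
        linarith

/-- This lets the `1/r` error from Euler's constant be absorbed in the main error term. -/
theorem half_inv_le_error {n r : ℕ} (hr : 0 < r) (hrn : r ≤ n) :
    1 / (2 * (r : ℝ)) ≤ n * Real.log (n / r + 1) / r ^ 2 := by
  have hr0 : (0 : ℝ) < r := by exact_mod_cast hr
  have hrn' : (r : ℝ) ≤ n := by exact_mod_cast hrn
  have h1 : 1 / 2 ≤ Real.log (n / r + 1) := by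
    have : (1 : ℝ) ≤ n / r := (one_le_div hr0).mpr hrn'
    have h2 := Real.log_le_log (by norm_num : (0 : ℝ) < 2) (by linarith : (2 : ℝ) ≤ n / r + 1)
    linarith [Real.log_two_gt_d9]
  calc 1 / (2 * (r : ℝ)) = r * (1 / 2) / r ^ 2 := by field_simp
    _ ≤ _ := by gcongr

theorem error_le_two {n r : ℕ} (hr : 0 < r) (hrn : r ≤ n)
    (h : Real.sqrt ((n : ℝ) * Real.log (n : ℝ)) ≤ (r : ℝ)) :
    n * Real.log (n / r + 1) / r ^ 2 ≤ 2 := by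
  have hr0 : (0 : ℝ) < r := by exact_mod_cast hr
  have hr1 : (1 : ℝ) ≤ r := by exact_mod_cast hr
  rcases (show n = 1 ∨ 2 ≤ n by omega) with rfl | hn
  -- Here `log n = 0`, so the square-root hypothesis carries no information.
  · obtain rfl : r = 1 := by omega
    have := Real.log_le_sub_one_of_pos (show (0 : ℝ) < 2 by norm_num)
    norm_num
    linarith
  · have hn' : (2 : ℝ) ≤ n := by exact_mod_cast hn
    have h1 := (Real.sqrt_le_left hr0.le).mp h
    have h2 : Real.log (n / r + 1) ≤ 2 * Real.log n := by
      rw [show 2 * Real.log n = Real.log ((n : ℝ) ^ 2) by rw [Real.log_pow]; norm_num]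
      refine Real.log_le_log (by positivity) ?_
      have : (n : ℝ) / r ≤ n := div_le_self (by positivity) hr1
      nlinarith
    rw [div_le_iff₀ (by positivity)]
    nlinarith

theorem coeff_ellSeries_bounds {n r : ℕ} (hr : 0 < r) (hrn : r ≤ n) :
    Real.exp (-(harmonic r : ℝ)) * dickman (n / r) ≤ PowerSeries.coeff n (ellSeries r) ∧
      PowerSeries.coeff n (ellSeries r) ≤ Real.exp (-(harmonic r : ℝ)) *
        (dickman (n / r) * Real.exp (48 * (n * Real.log (n / r + 1) / r ^ 2))) := by
  have hr0 : (0 : ℝ) < r := by exact_mod_cast hr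
  have hn0 : (0 : ℝ) < n := by exact_mod_cast hr.trans_le hrn
  have hE := Real.exp_pos (-(harmonic r : ℝ))
  set b : ℕ → ℝ := fun m => PowerSeries.coeff m (ellSeries r) / Real.exp (-(harmonic r : ℝ))
    with hb
  have h1 : ∀ m ≤ r, b m = 1 := fun m hm => by
    simp only [hb]
    rw [coeff_ellSeries_of_le hm, coeff_zero_ellSeries, div_self hE.ne']
  have hrec : ∀ m, r < m → m * b m = ∑ i ∈ Finset.range r, b (m - r + i) := fun m hm => by
    simp only [hb]
    rw [← Finset.sum_div, ← mul_coeff_ellSeries_of_le hm.le, mul_div_assoc]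
  have hL : 0 < Real.log (n / r + 1) := Real.log_pos (by
    have : (0 : ℝ) < n / r := by positivity
    linarith)
  have hlow := dickman_le_of_recurrence hr h1 hrec n
  have hup := le_dickman_mul_exp_of_recurrence hr h1 hrec hL le_rfl le_rfl
  have hbn : PowerSeries.coeff n (ellSeries r) = Real.exp (-(harmonic r : ℝ)) * b n := by
    simp only [hb]
    field_simp
  rw [hbn]
  refine ⟨by gcongr, mul_le_mul_of_nonneg_left (hup.trans_eq ?_) hE.le⟩
  ring_nf

theorem theorem3 :
    ∃ C : ℝ, 0 < C ∧
      ∀ (n r : ℕ), 1 ≤ n → 1 ≤ r →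
        Real.sqrt ((n : ℝ) * Real.log (n : ℝ)) ≤ (r : ℝ) → r ≤ n →
        ∀ (Ω : Type*) [MeasurableSpace Ω] (P : Measure Ω) [IsProbabilityMeasure P]
          (Z : ℕ → Ω → ℕ),
          (∀ j ∈ Finset.Icc 1 n, HasLaw (Z j) (poissonMeasure (1 / (j : NNReal))) P) →
          iIndepFun (fun j : Finset.Icc 1 n => Z j) P →
          ∃ B : ℝ, |B| ≤ C ∧
            P.real {ω | ell r (fun j => Z j ω) = n} =
              Real.exp (-Real.eulerMascheroniConstant) / (r : ℝ) *
                dickman ((n : ℝ) / (r : ℝ)) *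
                (1 + B * ((n : ℝ) * Real.log ((n : ℝ) / (r : ℝ) + 1) / (r : ℝ) ^ 2)) := by
  -- From `exp x - 1 ≤ x exp x` at `x = 48 E`, with `E ≤ 2`.
  refine ⟨48 * Real.exp 96, by positivity, ?_⟩
  intro n r _ hr hsqrt hrn Ω _ P _ Z hZ hi
  rw [measureReal_ell_eq hZ hi hrn]
  have hr0 : (0 : ℝ) < r := by exact_mod_cast hr
  obtain ⟨hlow, hup⟩ := coeff_ellSeries_bounds hr hrn
  have hE1 := half_inv_le_error hr hrn
  have hE2 := error_le_two hr hrn hsqrt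
  have hd := dickman_pos (n / r)
  set E := (n : ℝ) * Real.log ((n : ℝ) / (r : ℝ) + 1) / (r : ℝ) ^ 2
  set p := PowerSeries.coeff n (ellSeries r)
  set c := Real.exp (-Real.eulerMascheroniConstant) / (r : ℝ) with hc
  have hc0 : 0 < c := by positivity
  have hE0 : 0 < E := lt_of_lt_of_le (by positivity) hE1
  -- `B` is forced by the identity because `E > 0`; only its size remains to be bounded.
  refine ⟨(p / (c * dickman (n / r)) - 1) / E, ?_, by field_simp; ring⟩
  have h1 : 1 - 2 * E ≤ p / (c * dickman (n / r)) := by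
    rw [le_div_iff₀ (by positivity)]
    refine le_trans ?_ hlow
    have h2 : c * (1 - 2 * E) ≤ Real.exp (-(harmonic r : ℝ)) := by
      refine le_trans (mul_le_mul_of_nonneg_left ?_ hc0.le) (le_exp_neg_harmonic hr)
      have : 1 / (2 * (r : ℝ)) = 1 / r / 2 := by field_simp
      linarith
    calc (1 - 2 * E) * (c * dickman (n / r)) = c * (1 - 2 * E) * dickman (n / r) := by ring
      _ ≤ _ := by gcongr
  have h2 : p / (c * dickman (n / r)) ≤ Real.exp (48 * E) := by
    rw [div_le_iff₀ (by positivity)]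
    refine hup.trans ?_
    calc Real.exp (-(harmonic r : ℝ)) * (dickman (n / r) * Real.exp (48 * E))
        ≤ c * (dickman (n / r) * Real.exp (48 * E)) := by
          gcongr
          exact exp_neg_harmonic_le hr
      _ = _ := by ring
  have h3 : Real.exp (48 * E) - 1 ≤ 48 * Real.exp 96 * E := by
    have h4 := Real.add_one_le_exp (-(48 * E))
    have h5 : Real.exp (48 * E) * Real.exp (-(48 * E)) = 1 := by rw [← Real.exp_add]; simp
    have h6 : Real.exp (48 * E) ≤ Real.exp 96 := Real.exp_le_exp.mpr (by linarith)
    have h7 := Real.exp_pos (48 * E)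
    nlinarith
  rw [abs_le]
  constructor
  · rw [le_div_iff₀ hE0]
    have : (1 : ℝ) ≤ Real.exp 96 := Real.one_le_exp (by norm_num)
    nlinarith
  · rw [div_le_iff₀ hE0]
    linarith
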